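/- Let $v>-1$, let $0<q<1$, and put $\mathbb R_q^+=\{q^n : n\in\mathbb Z\}$, $(a;q)_n=\prod_{i=0}^{n-1}(1-aq^i)$ for $0\le n\le\infty$, and $\int_0^\infty f(x)\,d_qx=(1-q)\sum_{n\in\mathbb Z}q^nf(q^n)$. Let $\mathcal L_{q,1,v}$ be the space of functions $f:\mathbb R_q^+\to\mathbb C$ with $\int_0^\infty|f(x)|x^{2v+1}d_qx<\infty$, and let $\mathcal C_{q,b}$ be the space of bounded functions $f:\mathbb R_q^+\to\mathbb C$ that are continuous at $0$, i.e. for which $\lim_{n\to\infty}f(q^n)$ exists. Let $$j_v(x,q^2)=\sum_{n=0}^\infty(-1)^n\frac{q^{n(n+1)}}{(q^2;q^2)_n(q^{2v+2};q^2)_n}x^{2n}$$ be the normalized Hahn-Exton $q$-Bessel function, and put $c_{q,v}=\frac1{1-q}\frac{(q^{2v+2};q^2)_\infty}{(q^2;q^2)_\infty}$. For $f\in\mathcal L_{q,1,v}$ and $x,y\in\mathbb R_q^+$ define the $q$-Bessel Fourier transform and the $q$-Bessel translation by $$\mathcal F_{q,v}f(x)=c_{q,v}\int_0^\infty f(t)\,j_v(xt,q^2)\,t^{2v+1}d_qt,$$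 $$T^v_{q,x}f(y)=c_{q,v}\int_0^\infty\mathcal F_{q,v}f(t)\,j_v(xt,q^2)\,j_v(yt,q^2)\,t^{2v+1}d_qt.$$ Assume that $q\in Q_v$, i.e. that for all $x\in\mathbb R_q^+$ the operator $T^v_{q,x}$ is positive: $T^v_{q,x}f\ge0$ for every $f\in\mathcal L_{q,1,v}$ with $f\ge0$. Let $\mathcal A_{q,v}=\{f\in\mathcal L_{q,1,v}:\mathcal F_{q,v}f\in\mathcal L_{q,1,v}\}$ be the $q$-Wiener algebra. Let $\phi$ be of $q$-positive type, that is, $\phi\in\mathcal C_{q,b}\cap\mathcal L_{q,1,v}$ and $$\sum_{r=1}^n\sum_{l=1}^n z_r\overline{z_l}\,T^v_{q,x_r}\phi(x_l)\ge0$$ for all finite lists $z_1,\dots,z_n\in\mathbb C$ and $x_1,\dots,x_n\in\mathbb R_q^+$. Then there is a function $\xi\in\mathcal A_{q,v}$ with $\xi\ge0$ such that $\phi(x)=\mathcal F_{q,v}\xi(x)$ for all $x\in\mathbb R_q^+$; namely, $\xi=\mathcal F_{q,v}\phi$. -/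

import Mathlib

open scoped ComplexOrder Topology

noncomputable section

/-- The set `ℝ_q^+ = {q ^ n : n ∈ ℤ}` of `q`-real numbers. -/
def qReals (q : ℝ) : Set ℝ := {x | ∃ n : ℤ, x = q ^ n}

/-- The point `q ^ n` of `ℝ_q^+`. -/
def qPoint (q : ℝ) (n : ℤ) : qReals q := ⟨q ^ n, n, rfl⟩

/-- The finite `q`-shifted factorial `(a; q)_n = ∏_{i < n} (1 - a q ^ i)`. -/
def qPoch (a q : ℝ) (n : ℕ) : ℝ := ∏ i ∈ Finset.range n, (1 - a * q ^ i)

/-- The infinite `q`-shifted factorial `(a; q)_∞ = ∏_{i ≥ 0} (1 - a q ^ i)`. -/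
def qPochInf (a q : ℝ) : ℝ := ∏' i : ℕ, (1 - a * q ^ i)

/-- Jackson's `q`-integral over `[0, ∞)`:
`∫_0^∞ f(x) d_q x = (1 - q) ∑_{n ∈ ℤ} q ^ n f(q ^ n)`. -/
def jacksonIntegral (q : ℝ) (f : qReals q → ℂ) : ℂ :=
  ((1 - q : ℝ) : ℂ) * ∑' n : ℤ, ((q ^ n : ℝ) : ℂ) * f (qPoint q n)

/-- `f ∈ L_{q,1,v}`: the series (of nonnegative terms) that defines
`‖f‖_{q,1,v} = ∫_0^∞ |f(x)| x ^ (2 v + 1) d_q x` converges. -/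
def MemLq1 (q v : ℝ) (f : qReals q → ℂ) : Prop :=
  Summable fun n : ℤ => q ^ n * (‖f (qPoint q n)‖ * (q ^ n) ^ (2 * v + 1))

/-- `f ∈ C_{q,b}`: `f` is bounded and continuous at `0`, that is, `f(x)` has a limit as
`x → 0` in `ℝ_q^+`. -/
def MemCqb (q : ℝ) (f : qReals q → ℂ) : Prop :=
  (∃ C : ℝ, ∀ x, ‖f x‖ ≤ C) ∧
    ∃ L : ℂ, Filter.Tendsto f (Filter.comap (fun x : qReals q => (x : ℝ)) (𝓝 0)) (𝓝 L)

/-- The normalized Hahn-Exton `q`-Bessel function of order `v` and base `p`: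
`j_v(x, p) = ∑_n (-1)^n p ^ (n (n + 1) / 2) / ((p; p)_n (p ^ (v + 1); p)_n) x ^ (2 n)`. -/
def qBesselJ (v x p : ℝ) : ℝ :=
  ∑' n : ℕ, (-1) ^ n * p ^ (n * (n + 1) / 2) /
    (qPoch p p n * qPoch (p ^ (v + 1)) p n) * x ^ (2 * n)

/-- The constant `c_{q,v} = (1 / (1 - q)) (q ^ (2 v + 2); q ^ 2)_∞ / (q ^ 2; q ^ 2)_∞`. -/
def qBesselConst (q v : ℝ) : ℝ :=
  1 / (1 - q) * (qPochInf (q ^ (2 * v + 2)) (q ^ 2) / qPochInf (q ^ 2) (q ^ 2))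

/-- The `q`-Bessel Fourier transform
`F_{q,v} f(x) = c_{q,v} ∫_0^∞ f(t) j_v(x t, q ^ 2) t ^ (2 v + 1) d_q t`. -/
def qBesselFourier (q v : ℝ) (f : qReals q → ℂ) (x : qReals q) : ℂ :=
  (qBesselConst q v : ℂ) * jacksonIntegral q fun t =>
    f t * (qBesselJ v ((x : ℝ) * t) (q ^ 2) : ℂ) * (((t : ℝ) ^ (2 * v + 1) : ℝ) : ℂ)

/-- The `q`-Bessel translation `T^v_{q,x} f(y) =
c_{q,v} ∫_0^∞ F_{q,v} f(t) j_v(x t, q ^ 2) j_v(y t, q ^ 2) t ^ (2 v + 1) d_q t`. -/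
def qTranslation (q v : ℝ) (x : qReals q) (f : qReals q → ℂ) (y : qReals q) : ℂ :=
  (qBesselConst q v : ℂ) * jacksonIntegral q fun t =>
    qBesselFourier q v f t * (qBesselJ v ((x : ℝ) * t) (q ^ 2) : ℂ) *
      (qBesselJ v ((y : ℝ) * t) (q ^ 2) : ℂ) * (((t : ℝ) ^ (2 * v + 1) : ℝ) : ℂ)

/-- The set `Q_v` of those `q ∈ (0, 1)` for which every translation `T^v_{q,x}`,
`x ∈ ℝ_q^+`, is positive: it maps nonnegative functions of `L_{q,1,v}` to nonnegative
functions. -/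
def positivitySet (v : ℝ) : Set ℝ :=
  {q | 0 < q ∧ q < 1 ∧ ∀ x : qReals q, ∀ f : qReals q → ℂ,
    MemLq1 q v f → (∀ y, 0 ≤ f y) → ∀ y, 0 ≤ qTranslation q v x f y}

/-- The `q`-Wiener algebra `A_{q,v} = {f ∈ L_{q,1,v} : F_{q,v} f ∈ L_{q,1,v}}`. -/
def qWienerAlgebra (q v : ℝ) : Set (qReals q → ℂ) :=
  {f | MemLq1 q v f ∧ MemLq1 q v (qBesselFourier q v f)}

/-- Functions of `q`-positive type. The order on `ℂ` is the usual partial order: `0 ≤ w`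
means that `w` is real and nonnegative. -/
structure IsQPositiveType (q v : ℝ) (φ : qReals q → ℂ) : Prop where
  memCqb : MemCqb q φ
  memLq1 : MemLq1 q v φ
  posDef : ∀ (n : ℕ) (z : Fin n → ℂ) (x : Fin n → qReals q),
    0 ≤ ∑ r, ∑ l, z r * (starRingEnd ℂ) (z l) * qTranslation q v (x r) φ (x l)

end

open Filter

/-! Put `p = q ^ 2`, `a = q ^ (2 * v + 2)` and index `ℝ_q^+` by exponents. Then the measure `x ^
(2v+1) d_q x` becomes, up to the factor `1 - q`, the weight `a ^ n` on `ℤ`. The normalized Bessel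
function becomes `K = besselKernel a p`, the Laurent coefficients of `ψ(z) = (a/z; p)_∞ / (z; p)_∞`.
The transform is `f ↦ ∑ f(m) K(n + m) a ^ m`.

Inversion: `ψ(z) ψ(a/z) = 1` amounts to the orthogonality of the shifts of `K`
(`besselKernel_orthogonality`). Hence the transform is its own inverse on `ℓ¹(a ^ n)`
(`besselTransform_besselTransform`), so `φ` is the transform of `ξ = Fφ`.

Positivity: the positive-type condition says `∑ ξ(t) |h(t)|² a ^ t ≥ 0` for all finite combinations
`h` of the functions `K(x + ·)`. By orthogonality such `h` approximate point masses, so `ξ ≥ 0`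
(`nonneg_of_quadratic_form_nonneg`).

Integrability: as `ξ ≥ 0`, it is enough to bound `∑ ξ(n) a ^ n` over blocks of consecutive integers.
There the kernels telescope to two kernels of parameter `a * p`, whose weighted `ℓ¹` norms do not
depend on the block, and `φ` is bounded (`besselTransform_summable`). -/

theorem tsum_comm_of_norm_le {F : Type*} [NormedAddCommGroup F] [CompleteSpace F]
    {f : ℤ → ℤ → F} {u w : ℤ → ℝ} (hu : Summable u) (hw : Summable w)
    (hu0 : ∀ m, 0 ≤ u m) (hw0 : ∀ n, 0 ≤ w n) (h : ∀ m n, ‖f m n‖ ≤ u m * w n) :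
    ∑' m, ∑' n, f m n = ∑' n, ∑' m, f m n := by
  refine (Summable.tsum_comm (f := f) ?_).symm
  exact Summable.of_norm_bounded (hu.mul_of_nonneg hw hu0 hw0) fun x => h x.1 x.2

theorem summable_int_sub {F : Type*} [NormedAddCommGroup F] {f : ℤ → F} (hf : Summable f) (c : ℤ) :
    Summable fun k => f (k - c) :=
  (Equiv.subRight c).summable_iff.2 hf

theorem tsum_int_sub {F : Type*} [NormedAddCommGroup F] (f : ℤ → F) (c : ℤ) :
    ∑' k, f (k - c) = ∑' k, f k :=
  (Equiv.subRight c).tsum_eq f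

/-! ### Finite and infinite `q`-shifted factorials. -/

theorem qPoch_succ (a q : ℝ) (n : ℕ) : qPoch a q (n + 1) = qPoch a q n * (1 - a * q ^ n) :=
  Finset.prod_range_succ _ _

theorem qPoch_pos {a p : ℝ} (ha0 : 0 < a) (ha1 : a < 1) (hp0 : 0 < p) (hp1 : p < 1) (n : ℕ) :
    0 < qPoch a p n :=
  Finset.prod_pos fun i _ => by
    have h1 : p ^ i ≤ 1 := pow_le_one₀ hp0.le hp1.le
    have h2 : 0 < p ^ i := pow_pos hp0 i
    nlinarith

theorem tendsto_qPoch {a p : ℝ} (hp0 : 0 < p) (hp1 : p < 1) :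
    Tendsto (qPoch a p) atTop (𝓝 (qPochInf a p)) := by
  have hs : Summable fun i : ℕ => -(a * p ^ i) :=
    ((summable_geometric_of_lt_one hp0.le hp1).mul_left a).neg
  have h := (Real.multipliable_one_add_of_summable hs).hasProd.tendsto_prod_nat
  simp only [← sub_eq_add_neg] at h
  exact h

theorem qPochInf_pos {a p : ℝ} (ha0 : 0 < a) (ha1 : a < 1) (hp0 : 0 < p) (hp1 : p < 1) :
    0 < qPochInf a p := by
  have hs : Summable fun i : ℕ => ‖-(a * p ^ i)‖ :=
    ((summable_geometric_of_lt_one hp0.le hp1).mul_left a).neg.norm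
  have hne := tprod_one_add_ne_zero_of_summable (f := fun i : ℕ => -(a * p ^ i)) (fun i => by
    have h1 : p ^ i ≤ 1 := pow_le_one₀ hp0.le hp1.le
    have h2 : 0 < p ^ i := pow_pos hp0 i
    nlinarith) hs
  simp only [← sub_eq_add_neg] at hne
  exact lt_of_le_of_ne
    (ge_of_tendsto' (tendsto_qPoch hp0 hp1) fun n => (qPoch_pos ha0 ha1 hp0 hp1 n).le) hne.symm

theorem qPochInf_le_qPoch {a p : ℝ} (ha0 : 0 < a) (ha1 : a < 1) (hp0 : 0 < p) (hp1 : p < 1)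
    (n : ℕ) : qPochInf a p ≤ qPoch a p n := by
  have hanti : Antitone (qPoch a p) := antitone_nat_of_succ_le fun n => by
    rw [qPoch_succ]
    have := mul_pos ha0 (pow_pos hp0 n)
    nlinarith [qPoch_pos ha0 ha1 hp0 hp1 n]
  exact hanti.le_of_tendsto (tendsto_qPoch hp0 hp1) n

/-! ### Euler's expansions of `(z; p)_∞` and its reciprocal. -/

/-- The coefficients of Euler's expansion of `(z; p)_∞`, extended by zero to `ℤ`. -/
noncomputable def eulerCoeff (p : ℝ) : ℤ → ℝ
  | Int.ofNat n => (-1) ^ n * p ^ (n.choose 2) / qPoch p p n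
  | Int.negSucc _ => 0

/-- The coefficients of Euler's expansion of `1 / (z; p)_∞`, extended by zero to `ℤ`. -/
noncomputable def eulerInvCoeff (p : ℝ) : ℤ → ℝ
  | Int.ofNat n => 1 / qPoch p p n
  | Int.negSucc _ => 0

theorem eulerCoeff_natCast (p : ℝ) (n : ℕ) :
    eulerCoeff p n = (-1) ^ n * p ^ (n.choose 2) / qPoch p p n := rfl

theorem eulerInvCoeff_natCast (p : ℝ) (n : ℕ) : eulerInvCoeff p n = 1 / qPoch p p n := rfl

theorem eulerCoeff_of_neg (p : ℝ) {n : ℤ} (hn : n < 0) : eulerCoeff p n = 0 := by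
  cases n with
  | ofNat n => simp at hn; omega
  | negSucc n => rfl

theorem eulerInvCoeff_of_neg (p : ℝ) {n : ℤ} (hn : n < 0) : eulerInvCoeff p n = 0 := by
  cases n with
  | ofNat n => simp at hn; omega
  | negSucc n => rfl

theorem eulerCoeff_zero (p : ℝ) : eulerCoeff p 0 = 1 := by
  have := eulerCoeff_natCast p 0
  simpa [qPoch] using this

theorem eulerInvCoeff_zero (p : ℝ) : eulerInvCoeff p 0 = 1 := by
  have := eulerInvCoeff_natCast p 0
  simpa [qPoch] using this

theorem exists_natCast_succ_or {k : ℤ} : k < 0 ∨ k = 0 ∨ ∃ n : ℕ, k = n + 1 := by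
  rcases lt_trichotomy k 0 with h | h | h
  · exact Or.inl h
  · exact Or.inr (Or.inl h)
  · exact Or.inr (Or.inr ⟨(k - 1).toNat, by omega⟩)

/-- Coefficient form of `(z; p)_∞ = (1 - z) (pz; p)_∞`. Extension by zero makes it valid on all of
`ℤ` (at `k = 0` both sides vanish), so later sums can be shifted without boundary terms. -/
theorem eulerCoeff_rec {p : ℝ} (hp0 : 0 < p) (hp1 : p < 1) (k : ℤ) :
    eulerCoeff p k * (1 - p ^ k) = -(p ^ (k - 1) * eulerCoeff p (k - 1)) := by
  rcases exists_natCast_succ_or (k := k) with h | rfl | ⟨n, rfl⟩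
  · rw [eulerCoeff_of_neg p h, eulerCoeff_of_neg p (by omega)]; simp
  · rw [eulerCoeff_of_neg p (by omega : (0 : ℤ) - 1 < 0)]; simp
  · have h1 := (qPoch_pos hp0 hp1 hp0 hp1 (n + 1)).ne'
    have h2 := (qPoch_pos hp0 hp1 hp0 hp1 n).ne'
    rw [add_sub_cancel_right, zpow_natCast, ← Nat.cast_succ, zpow_natCast, eulerCoeff_natCast,
      eulerCoeff_natCast, Nat.succ_eq_add_one]
    rw [qPoch_succ] at h1 ⊢
    have h3 := right_ne_zero_of_mul h1
    have h4 : (n + 1).choose 2 = n + n.choose 2 := by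
      rw [Nat.choose_succ_succ' n 1, Nat.choose_one_right]
    rw [h4]
    have h5 : 1 - p ^ (n + 1) ≠ 0 := by rwa [pow_succ']
    field_simp
    rw [pow_succ' p n]
    ring

theorem eulerInvCoeff_rec {p : ℝ} (hp0 : 0 < p) (hp1 : p < 1) (k : ℤ) :
    eulerInvCoeff p k * (1 - p ^ k) = eulerInvCoeff p (k - 1) := by
  rcases exists_natCast_succ_or (k := k) with h | rfl | ⟨n, rfl⟩
  · rw [eulerInvCoeff_of_neg p h, eulerInvCoeff_of_neg p (by omega)]; simp
  · rw [eulerInvCoeff_of_neg p (by omega : (0 : ℤ) - 1 < 0)]; simp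
  · have h1 := (qPoch_pos hp0 hp1 hp0 hp1 (n + 1)).ne'
    have h2 := (qPoch_pos hp0 hp1 hp0 hp1 n).ne'
    rw [add_sub_cancel_right, ← Nat.cast_succ, zpow_natCast, eulerInvCoeff_natCast,
      eulerInvCoeff_natCast, Nat.succ_eq_add_one]
    rw [qPoch_succ] at h1 ⊢
    have h3 := right_ne_zero_of_mul h1
    rw [pow_succ']
    field_simp

theorem eulerInvCoeff_nonneg {p : ℝ} (hp0 : 0 < p) (hp1 : p < 1) (k : ℤ) :
    0 ≤ eulerInvCoeff p k := by
  cases k with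
  | ofNat n => exact one_div_nonneg.2 (qPoch_pos hp0 hp1 hp0 hp1 n).le
  | negSucc n => exact le_rfl

theorem eulerInvCoeff_le {p : ℝ} (hp0 : 0 < p) (hp1 : p < 1) (k : ℤ) :
    eulerInvCoeff p k ≤ 1 / qPochInf p p := by
  have h := qPochInf_pos hp0 hp1 hp0 hp1
  cases k with
  | ofNat n => exact one_div_le_one_div_of_le h (qPochInf_le_qPoch hp0 hp1 hp0 hp1 n)
  | negSucc n => exact (one_div_pos.2 h).le

theorem summable_int_of_nat {F : Type*} [NormedAddCommGroup F] {f : ℤ → F}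
    (hf : ∀ k < 0, f k = 0) (h : Summable fun n : ℕ => f n) : Summable f :=
  (Nat.cast_injective.summable_iff fun k hk => hf k <| by
    by_contra! hk0
    exact hk ⟨k.toNat, by simp [hk0]⟩).1 h

theorem tsum_int_eq_nat {F : Type*} [NormedAddCommGroup F] {f : ℤ → F}
    (hf : ∀ k < 0, f k = 0) : ∑' n : ℕ, f n = ∑' k : ℤ, f k :=
  Nat.cast_injective.tsum_eq fun k hk => by
    by_contra hk'
    refine hk (hf k ?_)
    by_contra! hk0
    exact hk' ⟨k.toNat, by simp [hk0]⟩

/-- Consecutive terms have ratio `p ^ n * b / (1 - p ^ (n + 1)) → 0`, so every `b > 0` is allowed.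
-/
theorem eulerCoeff_summable {p b : ℝ} (hp0 : 0 < p) (hp1 : p < 1) (hb : 0 < b) :
    Summable fun k : ℤ => |eulerCoeff p k| * b ^ k := by
  refine summable_int_of_nat (fun k hk => by simp [eulerCoeff_of_neg p hk]) ?_
  have hpos : ∀ n : ℕ, 0 < |eulerCoeff p n| := fun n => by
    have := qPoch_pos hp0 hp1 hp0 hp1 n
    rw [eulerCoeff_natCast, abs_pos]
    positivity
  refine summable_of_ratio_test_tendsto_lt_one (l := 0) one_pos
    (Eventually.of_forall fun n => (mul_pos (hpos n) (by positivity)).ne') ?_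
  have hlt : ∀ n : ℕ, p ^ (n + 1) < 1 := fun n => pow_lt_one₀ hp0.le hp1 n.succ_ne_zero
  have key : ∀ n : ℕ, ‖|eulerCoeff p ((n + 1 : ℕ) : ℤ)| * b ^ ((n + 1 : ℕ) : ℤ)‖ /
      ‖|eulerCoeff p (n : ℤ)| * b ^ (n : ℤ)‖ = p ^ n * b / (1 - p ^ (n + 1)) := fun n => by
    have h := congrArg abs (eulerCoeff_rec hp0 hp1 ((n + 1 : ℕ) : ℤ))
    have h1 : (((n + 1 : ℕ) : ℤ) - 1) = n := by push_cast; ring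
    rw [h1, zpow_natCast, zpow_natCast, abs_neg, abs_mul, abs_mul,
      abs_of_pos (sub_pos.2 (hlt n)), abs_of_pos (pow_pos hp0 n)] at h
    have h2 := hpos n
    have h3 := sub_pos.2 (hlt n)
    rw [Real.norm_of_nonneg (by positivity), Real.norm_of_nonneg (by positivity),
      zpow_natCast, zpow_natCast, div_eq_div_iff (by positivity) h3.ne', pow_succ b]
    linear_combination b ^ n * b * h
  simp only [key]
  have t1 : Tendsto (fun n : ℕ => p ^ n) atTop (𝓝 0) :=
    tendsto_pow_atTop_nhds_zero_of_lt_one hp0.le hp1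
  have t2 : Tendsto (fun n : ℕ => p ^ (n + 1)) atTop (𝓝 0) := t1.comp (tendsto_add_atTop_nat 1)
  have t3 := (t1.mul_const b).div (t2.const_sub 1) (by simp)
  rw [zero_mul, zero_div] at t3
  exact t3

theorem eulerInvCoeff_summable {p b : ℝ} (hp0 : 0 < p) (hp1 : p < 1) (hb0 : 0 < b) (hb1 : b < 1) :
    Summable fun k : ℤ => eulerInvCoeff p k * b ^ k := by
  refine summable_int_of_nat (fun k hk => by simp [eulerInvCoeff_of_neg p hk]) ?_
  refine Summable.of_nonneg_of_le
    (fun n => mul_nonneg (eulerInvCoeff_nonneg hp0 hp1 _) (zpow_nonneg hb0.le _)) (fun n => ?_)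
    ((summable_geometric_of_lt_one hb0.le hb1).mul_left (1 / qPochInf p p))
  rw [zpow_natCast]
  exact mul_le_mul_of_nonneg_right (eulerInvCoeff_le hp0 hp1 _) (by positivity)

/-- The coefficients of `(z; p)_∞` and `1 / (z; p)_∞` are inverse to each other under
convolution. -/
theorem eulerCoeff_conv {p : ℝ} (hp0 : 0 < p) (hp1 : p < 1) (n : ℤ) :
    ∑' k : ℤ, eulerCoeff p k * eulerInvCoeff p (n - k) = if n = 0 then 1 else 0 := by
  split_ifs with hn
  · subst hn
    rw [tsum_eq_single 0]
    · simp [eulerCoeff_zero, eulerInvCoeff_zero]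
    · intro k hk
      rcases lt_or_gt_of_ne hk with h | h
      · simp [eulerCoeff_of_neg p h]
      · rw [eulerInvCoeff_of_neg p (by omega : 0 - k < 0), mul_zero]
  · have hsum : ∀ (b : ℝ) (m : ℤ), 0 < b →
        Summable fun k : ℤ => b ^ k * eulerCoeff p k * eulerInvCoeff p (m - k) := by
      intro b m hb
      refine Summable.of_norm_bounded
        ((eulerCoeff_summable hp0 hp1 hb).mul_right (1 / qPochInf p p)) fun k => ?_
      rw [norm_mul, norm_mul, Real.norm_eq_abs, Real.norm_eq_abs, Real.norm_eq_abs,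
        abs_of_nonneg (eulerInvCoeff_nonneg hp0 hp1 _), abs_of_pos (zpow_pos hb k),
        mul_comm (b ^ k)]
      exact mul_le_mul_of_nonneg_left (eulerInvCoeff_le hp0 hp1 _) (by positivity)
    -- Splitting `1 - p ^ n` as `(1 - p ^ k) + p ^ k (1 - p ^ (n - k))` and applying both
    -- recurrences turns each term into a difference of consecutive values of one summable sequence,
    -- so the sum is zero.
    have h0 : (1 - p ^ n) * ∑' k : ℤ, eulerCoeff p k * eulerInvCoeff p (n - k) = 0 := by
      rw [← tsum_mul_left]
      have hterm : ∀ k : ℤ, (1 - p ^ n) * (eulerCoeff p k * eulerInvCoeff p (n - k)) =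
          p ^ k * eulerCoeff p k * eulerInvCoeff p (n - 1 - k) -
            p ^ (k - 1) * eulerCoeff p (k - 1) * eulerInvCoeff p (n - 1 - (k - 1)) := fun k => by
        have h1 := eulerCoeff_rec hp0 hp1 k
        have h2 := eulerInvCoeff_rec hp0 hp1 (n - k)
        have h3 : p ^ n = p ^ k * p ^ (n - k) := by rw [← zpow_add₀ hp0.ne']; congr 1; ring
        rw [show n - 1 - k = n - k - 1 by ring, show n - 1 - (k - 1) = n - k by ring, ← h2, h3]
        linear_combination eulerInvCoeff p (n - k) * h1
      have hs := hsum p (n - 1) hp0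
      have hs' : Summable fun k : ℤ =>
          p ^ (k - 1) * eulerCoeff p (k - 1) * eulerInvCoeff p (n - 1 - (k - 1)) :=
        summable_int_sub hs 1
      simp only [hterm]
      rw [Summable.tsum_sub hs hs', sub_eq_zero]
      exact (tsum_int_sub (fun k => p ^ k * eulerCoeff p k * eulerInvCoeff p (n - 1 - k)) 1).symm
    refine (mul_eq_zero.1 h0).resolve_left fun h => hn ?_
    exact (zpow_eq_one_iff_right₀ hp0.le hp1.ne).1 (sub_eq_zero.1 h).symm

/-- Euler's series for `(z; p)_∞`. -/
noncomputable def eulerSeries (p z : ℝ) : ℝ := ∑' k : ℤ, eulerCoeff p k * z ^ k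

theorem eulerSeries_summable {p z : ℝ} (hp0 : 0 < p) (hp1 : p < 1) (hz : 0 < z) :
    Summable fun k : ℤ => eulerCoeff p k * z ^ k :=
  Summable.of_norm_bounded (eulerCoeff_summable hp0 hp1 hz) fun k => by
    rw [norm_mul, Real.norm_eq_abs, Real.norm_eq_abs, abs_of_pos (zpow_pos hz k)]

theorem eulerSeries_eq_mul {p z : ℝ} (hp0 : 0 < p) (hp1 : p < 1) (hz : 0 < z) :
    eulerSeries p z = (1 - z) * eulerSeries p (p * z) := by
  have hs := eulerSeries_summable hp0 hp1 (mul_pos hp0 hz)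
  have hterm : ∀ k : ℤ, eulerCoeff p k * z ^ k = eulerCoeff p k * (p * z) ^ k -
      z * (eulerCoeff p (k - 1) * (p * z) ^ (k - 1)) := fun k => by
    have h1 := eulerCoeff_rec hp0 hp1 k
    have h2 : z ^ k = z * z ^ (k - 1) := by rw [← zpow_one_add₀ hz.ne']; congr 1; ring
    rw [mul_zpow, mul_zpow]
    rw [h2]
    linear_combination z * z ^ (k - 1) * h1
  have hs' : Summable fun k : ℤ => eulerCoeff p (k - 1) * (p * z) ^ (k - 1) :=
    summable_int_sub hs 1
  have hshift : ∑' k : ℤ, eulerCoeff p (k - 1) * (p * z) ^ (k - 1) = eulerSeries p (p * z) :=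
    tsum_int_sub (fun k => eulerCoeff p k * (p * z) ^ k) 1
  rw [eulerSeries, tsum_congr hterm, Summable.tsum_sub hs (hs'.mul_left z), tsum_mul_left, hshift,
    eulerSeries]
  ring

theorem eulerSeries_eq_qPoch_mul {p z : ℝ} (hp0 : 0 < p) (hp1 : p < 1) (hz : 0 < z) (n : ℕ) :
    eulerSeries p z = qPoch z p n * eulerSeries p (z * p ^ n) := by
  induction n with
  | zero => simp [qPoch]
  | succ n ih =>
    rw [ih, qPoch_succ, eulerSeries_eq_mul hp0 hp1 (by positivity), pow_succ,
      show p * (z * p ^ n) = z * (p ^ n * p) by ring]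
    ring

/-- Iterating the functional equation leaves the factor `eulerSeries p (z * p ^ n)`, which tends to
the constant term `1` by dominated convergence. -/
theorem eulerSeries_eq_qPochInf {p z : ℝ} (hp0 : 0 < p) (hp1 : p < 1) (hz : 0 < z) :
    eulerSeries p z = qPochInf z p := by
  have hlim : Tendsto (fun n : ℕ => eulerSeries p (z * p ^ n)) atTop (𝓝 1) := by
    have h1 : (1 : ℝ) = ∑' k : ℤ, if k = 0 then (1 : ℝ) else 0 := by rw [tsum_ite_eq]
    rw [h1]
    refine tendsto_tsum_of_dominated_convergence (eulerCoeff_summable hp0 hp1 hz) (fun k => ?_)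
      (Eventually.of_forall fun n k => ?_)
    · rcases exists_natCast_succ_or (k := k) with h | rfl | ⟨m, rfl⟩
      · simp [eulerCoeff_of_neg p h, h.ne]
      · simp [eulerCoeff_zero]
      · rw [if_neg (by omega)]
        have h2 : Tendsto (fun n : ℕ => z * p ^ n) atTop (𝓝 0) := by
          simpa using (tendsto_pow_atTop_nhds_zero_of_lt_one hp0.le hp1).const_mul z
        have h3 := (h2.pow (m + 1)).const_mul (eulerCoeff p (m + 1))
        simpa only [← zpow_natCast, Nat.cast_add, Nat.cast_one, ne_eq, Nat.succ_ne_zero,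
          not_false_eq_true, zero_pow, mul_zero, zero_zpow _ (by omega : (m : ℤ) + 1 ≠ 0)] using h3
    · rw [norm_mul, Real.norm_eq_abs, Real.norm_eq_abs,
        abs_of_pos (zpow_pos (mul_pos hz (pow_pos hp0 n)) k)]
      by_cases hk : k < 0
      · simp [eulerCoeff_of_neg p hk]
      · refine mul_le_mul_of_nonneg_left ?_ (abs_nonneg _)
        exact zpow_le_zpow_left₀ (by omega) (by positivity)
          (mul_le_of_le_one_right hz.le (pow_le_one₀ hp0.le hp1.le))
  have h := (tendsto_qPoch (a := z) hp0 hp1).mul hlim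
  simp only [← eulerSeries_eq_qPoch_mul hp0 hp1 hz, mul_one] at h
  exact tendsto_nhds_unique tendsto_const_nhds h

/-- For `m ≥ 0` this is `(p; p)_∞ / (p; p)_m = (p ^ (m+1); p)_∞`. For `m < 0` the product on the
right contains a zero factor, matching the extension by zero. -/
theorem eulerInvCoeff_mul_eulerSeries {p : ℝ} (hp0 : 0 < p) (hp1 : p < 1) (m : ℤ) :
    eulerInvCoeff p m * eulerSeries p p = eulerSeries p (p ^ (m + 1)) := by
  rcases lt_or_ge m 0 with h | h
  · obtain ⟨n, rfl⟩ : ∃ n : ℕ, m = -(n : ℤ) - 1 := ⟨(-m - 1).toNat, by omega⟩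
    have h0 : qPoch (p ^ (-(n : ℤ))) p (n + 1) = 0 := by
      rw [qPoch_succ, ← zpow_natCast, ← zpow_add₀ hp0.ne']
      simp
    rw [eulerInvCoeff_of_neg p h, sub_add_cancel,
      eulerSeries_eq_qPoch_mul hp0 hp1 (zpow_pos hp0 _) (n + 1), h0, zero_mul, zero_mul]
  · lift m to ℕ using h
    rw [eulerSeries_eq_qPoch_mul hp0 hp1 hp0 m, eulerInvCoeff_natCast, ← mul_assoc,
      one_div_mul_cancel (qPoch_pos hp0 hp1 hp0 hp1 m).ne', one_mul, ← pow_succ',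
      ← zpow_natCast]
    norm_cast

/-! ### The Bessel kernel: decay, orthogonality, contiguity, and link with `j_v`. -/

/-- The Laurent coefficients of `(a / z; p)_∞ / (z; p)_∞`; up to normalization these are the
values of the Hahn-Exton `q`-Bessel function on `ℝ_q^+`. -/
noncomputable def besselKernel (a p : ℝ) (m : ℤ) : ℝ :=
  ∑' l : ℤ, eulerCoeff p l * a ^ l * eulerInvCoeff p (m + l)

theorem abs_eulerCoeff_mul_le {a p : ℝ} (ha : 0 < a) (hp0 : 0 < p) (hp1 : p < 1) (l m : ℤ) :
    ‖eulerCoeff p l * a ^ l * eulerInvCoeff p m‖ ≤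
      |eulerCoeff p l| * a ^ l * (1 / qPochInf p p) := by
  rw [norm_mul, norm_mul, Real.norm_eq_abs, Real.norm_eq_abs, Real.norm_eq_abs,
    abs_of_nonneg (eulerInvCoeff_nonneg hp0 hp1 _), abs_of_pos (zpow_pos ha l)]
  have := zpow_pos ha l
  exact mul_le_mul_of_nonneg_left (eulerInvCoeff_le hp0 hp1 _) (by positivity)

theorem besselKernel_summable {a p : ℝ} (ha : 0 < a) (hp0 : 0 < p) (hp1 : p < 1) (m : ℤ) :
    Summable fun l : ℤ => eulerCoeff p l * a ^ l * eulerInvCoeff p (m + l) :=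
  Summable.of_norm_bounded ((eulerCoeff_summable hp0 hp1 ha).mul_right _)
    fun l => abs_eulerCoeff_mul_le ha hp0 hp1 l _

theorem exists_abs_besselKernel_le {a p : ℝ} (ha : 0 < a) (hp0 : 0 < p) (hp1 : p < 1) :
    ∃ M, 0 ≤ M ∧ ∀ m, |besselKernel a p m| ≤ M := by
  have h : ∀ m, |besselKernel a p m| ≤ ∑' l : ℤ, |eulerCoeff p l| * a ^ l * (1 / qPochInf p p) :=
    fun m => tsum_of_norm_bounded ((eulerCoeff_summable hp0 hp1 ha).mul_right _).hasSum
      fun l => abs_eulerCoeff_mul_le ha hp0 hp1 l _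
  exact ⟨_, (abs_nonneg _).trans (h 0), h⟩

theorem besselKernel_weighted_summable {a b p : ℝ} (ha : 0 < a) (hb0 : 0 < b) (hb1 : b < 1)
    (hp0 : 0 < p) (hp1 : p < 1) : Summable fun m : ℤ => |besselKernel a p m| * b ^ m := by
  -- Since `a ^ l * b ^ m = (a / b) ^ l * b ^ (m + l)`, the double series is dominated by a product
  -- of two convergent ones in the variables `l` and `m + l`.
  have h := (eulerCoeff_summable hp0 hp1 (div_pos ha hb0)).mul_of_nonneg
    (eulerInvCoeff_summable hp0 hp1 hb0 hb1) (fun l => by positivity)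
    (fun m => mul_nonneg (eulerInvCoeff_nonneg hp0 hp1 m) (by positivity))
  have hinj : Function.Injective fun x : ℤ × ℤ => (x.2, x.1 + x.2) := by
    rintro ⟨m, l⟩ ⟨m', l'⟩ h
    simp only [Prod.mk.injEq] at h ⊢
    omega
  have h2 := (h.comp_injective hinj).prod
  refine Summable.of_nonneg_of_le (fun m => by positivity) (fun m => ?_) h2
  have hterm : ∀ l : ℤ, |eulerCoeff p l| * (a / b) ^ l * (eulerInvCoeff p (m + l) * b ^ (m + l)) =
      ‖eulerCoeff p l * a ^ l * eulerInvCoeff p (m + l)‖ * b ^ m := fun l => by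
    rw [norm_mul, norm_mul, Real.norm_eq_abs, Real.norm_eq_abs, Real.norm_eq_abs,
      abs_of_nonneg (eulerInvCoeff_nonneg hp0 hp1 _), abs_of_pos (zpow_pos ha l), div_zpow,
      zpow_add₀ hb0.ne']
    have := (zpow_pos hb0 l).ne'
    field_simp
  simp only [Function.comp_apply, hterm]
  rw [tsum_mul_right]
  exact mul_le_mul_of_nonneg_right
    (norm_tsum_le_tsum_norm (besselKernel_summable ha hp0 hp1 m).norm) (by positivity)

/-- Coefficient form of `(z; p)_∞ ψ(z) = (a/z; p)_∞`. -/
theorem tsum_eulerCoeff_mul_besselKernel {a p : ℝ} (ha : 0 < a) (hp0 : 0 < p) (hp1 : p < 1)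
    (n : ℤ) : ∑' k : ℤ, eulerCoeff p k * besselKernel a p (n - k) =
      eulerCoeff p (-n) * a ^ (-n) := by
  have hswap : ∑' k : ℤ, ∑' l : ℤ,
      eulerCoeff p k * (eulerCoeff p l * a ^ l * eulerInvCoeff p (n - k + l)) =
      ∑' l : ℤ, ∑' k : ℤ,
        eulerCoeff p k * (eulerCoeff p l * a ^ l * eulerInvCoeff p (n - k + l)) := by
    refine tsum_comm_of_norm_le (u := fun k => |eulerCoeff p k| * 1 ^ k)
      (eulerCoeff_summable hp0 hp1 one_pos)
      ((eulerCoeff_summable hp0 hp1 ha).mul_right (1 / qPochInf p p))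
      (fun k => by positivity) (fun l => ?_) fun k l => ?_
    · have := qPochInf_pos hp0 hp1 hp0 hp1
      positivity
    · rw [norm_mul, Real.norm_eq_abs, one_zpow, mul_one]
      exact mul_le_mul_of_nonneg_left (abs_eulerCoeff_mul_le ha hp0 hp1 l _) (abs_nonneg _)
  have hinner : ∀ l : ℤ, ∑' k : ℤ,
      eulerCoeff p k * (eulerCoeff p l * a ^ l * eulerInvCoeff p (n - k + l)) =
      if l = -n then eulerCoeff p l * a ^ l else 0 := fun l => by
    have h : ∀ k : ℤ, eulerCoeff p k * (eulerCoeff p l * a ^ l * eulerInvCoeff p (n - k + l)) =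
        eulerCoeff p l * a ^ l * (eulerCoeff p k * eulerInvCoeff p (n + l - k)) := fun k => by
      rw [show n - k + l = n + l - k by ring]; ring
    rw [tsum_congr h, tsum_mul_left, eulerCoeff_conv hp0 hp1]
    by_cases hl : l = -n
    · rw [if_pos hl, if_pos (by omega), mul_one]
    · rw [if_neg hl, if_neg (by omega), mul_zero]
  simp only [besselKernel, ← tsum_mul_left]
  rw [hswap, tsum_congr hinner, tsum_ite_eq]

/-- Coefficient form of `ψ(z) ψ(a/z) = 1`. Expand the second kernel and put `s = m + k`; the sum
over `k` cancels the denominator of the first kernel, and what remains is the convolution of the two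
Euler sequences. -/
theorem besselKernel_orthogonality_aux {a p : ℝ} (ha0 : 0 < a) (ha1 : a < 1) (hp0 : 0 < p)
    (hp1 : p < 1) (d : ℤ) :
    ∑' m : ℤ, besselKernel a p (m + d) * besselKernel a p m * a ^ m = if d = 0 then 1 else 0 := by
  obtain ⟨M, hM0, hM⟩ := exists_abs_besselKernel_le ha0 hp0 hp1
  have hP := qPochInf_pos hp0 hp1 hp0 hp1
  have hK : Summable fun m : ℤ => |besselKernel a p (m + d)| * a ^ m := by
    have h := (summable_int_sub (besselKernel_weighted_summable ha0 ha0 ha1 hp0 hp1)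
      (-d)).mul_right (a ^ (-d))
    refine h.congr fun m => ?_
    rw [sub_neg_eq_add, mul_assoc, ← zpow_add₀ ha0.ne', add_neg_cancel_right]
  have hswap1 : ∑' m : ℤ, ∑' k : ℤ, besselKernel a p (m + d) * a ^ m *
        (eulerCoeff p k * a ^ k * eulerInvCoeff p (m + k)) =
      ∑' k : ℤ, ∑' m : ℤ, besselKernel a p (m + d) * a ^ m *
        (eulerCoeff p k * a ^ k * eulerInvCoeff p (m + k)) := by
    refine tsum_comm_of_norm_le hK ((eulerCoeff_summable hp0 hp1 ha0).mul_right (1 / qPochInf p p))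
      (fun m => by positivity) (fun k => by positivity) fun m k => ?_
    rw [norm_mul, norm_mul, Real.norm_eq_abs, Real.norm_eq_abs (a ^ m), abs_of_pos (zpow_pos ha0 m)]
    exact mul_le_mul_of_nonneg_left (abs_eulerCoeff_mul_le ha0 hp0 hp1 k _) (by positivity)
  have hshift : ∀ k : ℤ, ∑' m : ℤ, besselKernel a p (m + d) * a ^ m *
        (eulerCoeff p k * a ^ k * eulerInvCoeff p (m + k)) =
      ∑' s : ℤ, eulerCoeff p k * (besselKernel a p (s + d - k) * (eulerInvCoeff p s * a ^ s)) :=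
    fun k => by
      rw [← tsum_int_sub _ k]
      refine tsum_congr fun s => ?_
      have h : a ^ s = a ^ (s - k) * a ^ k := by rw [← zpow_add₀ ha0.ne', sub_add_cancel]
      rw [h, sub_add_cancel, show s - k + d = s + d - k by ring]
      ring
  have hswap2 : ∑' k : ℤ, ∑' s : ℤ,
        eulerCoeff p k * (besselKernel a p (s + d - k) * (eulerInvCoeff p s * a ^ s)) =
      ∑' s : ℤ, ∑' k : ℤ,
        eulerCoeff p k * (besselKernel a p (s + d - k) * (eulerInvCoeff p s * a ^ s)) := by
    refine tsum_comm_of_norm_le (u := fun k => |eulerCoeff p k| * 1 ^ k)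
      (eulerCoeff_summable hp0 hp1 one_pos)
      ((eulerInvCoeff_summable hp0 hp1 ha0 ha1).mul_left M) (fun k => by positivity)
      (fun s => ?_) fun k s => ?_
    · have := eulerInvCoeff_nonneg hp0 hp1 s
      positivity
    · have h1 : 0 ≤ eulerInvCoeff p s * a ^ s :=
        mul_nonneg (eulerInvCoeff_nonneg hp0 hp1 s) (by positivity)
      rw [norm_mul, norm_mul, Real.norm_of_nonneg h1, Real.norm_eq_abs, Real.norm_eq_abs, one_zpow,
        mul_one]
      exact mul_le_mul_of_nonneg_left (mul_le_mul_of_nonneg_right (hM _) h1) (abs_nonneg _)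
  have hinner : ∀ s : ℤ, ∑' k : ℤ,
        eulerCoeff p k * (besselKernel a p (s + d - k) * (eulerInvCoeff p s * a ^ s)) =
      eulerCoeff p (-d - s) * eulerInvCoeff p s * a ^ (-d) := fun s => by
    simp only [← mul_assoc]
    rw [tsum_mul_right, tsum_mul_right, tsum_eulerCoeff_mul_besselKernel ha0 hp0 hp1,
      show -(s + d) = -d - s by ring, show a ^ (-d) = a ^ (-d - s) * a ^ s by
        rw [← zpow_add₀ ha0.ne', sub_add_cancel]]
    ring
  have hstart : ∀ m : ℤ, besselKernel a p (m + d) * besselKernel a p m * a ^ m =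
      ∑' k : ℤ, besselKernel a p (m + d) * a ^ m *
        (eulerCoeff p k * a ^ k * eulerInvCoeff p (m + k)) := fun m => by
    rw [tsum_mul_left, ← besselKernel]; ring
  rw [tsum_congr hstart, hswap1, tsum_congr hshift, hswap2, tsum_congr hinner, tsum_mul_right]
  have hrefl : ∑' s : ℤ, eulerCoeff p (-d - s) * eulerInvCoeff p s =
      ∑' k : ℤ, eulerCoeff p k * eulerInvCoeff p (-d - k) := by
    rw [← (Equiv.subLeft (-d)).tsum_eq]
    exact tsum_congr fun s => by simp
  rw [hrefl, eulerCoeff_conv hp0 hp1]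
  by_cases hd : d = 0
  · simp [hd]
  · simp [hd]

/-- The orthogonality relations of Koornwinder and Swarttouw. -/
theorem besselKernel_orthogonality {a p : ℝ} (ha0 : 0 < a) (ha1 : a < 1) (hp0 : 0 < p)
    (hp1 : p < 1) (n l : ℤ) :
    ∑' m : ℤ, besselKernel a p (n + m) * besselKernel a p (l + m) * a ^ m =
      if n = l then a ^ (-l) else 0 := by
  rw [← tsum_int_sub _ l]
  have hterm : ∀ m : ℤ, besselKernel a p (n + (m - l)) * besselKernel a p (l + (m - l)) *
      a ^ (m - l) = besselKernel a p (m + (n - l)) * besselKernel a p m * a ^ m * a ^ (-l) :=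
    fun m => by
      rw [show n + (m - l) = m + (n - l) by ring, show l + (m - l) = m by ring, sub_eq_add_neg m l,
        zpow_add₀ ha0.ne']
      ring
  rw [tsum_congr hterm, tsum_mul_right, besselKernel_orthogonality_aux ha0 ha1 hp0 hp1]
  by_cases h : n = l
  · simp [h]
  · simp [h, sub_eq_zero]

/-- From `(a/z; p)_∞ = (1 - a/z) (ap/z; p)_∞`. With weights `a ^ j` the right-hand sides telescope.
-/
theorem besselKernel_eq_sub {a p : ℝ} (ha : 0 < a) (hp0 : 0 < p) (hp1 : p < 1) (m : ℤ) :
    besselKernel a p m = besselKernel (a * p) p m - a * besselKernel (a * p) p (m + 1) := by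
  have hap := mul_pos ha hp0
  have hs := besselKernel_summable hap hp0 hp1 m
  have hs' := summable_int_sub (besselKernel_summable hap hp0 hp1 (m + 1)) 1
  have hshift := tsum_int_sub
    (fun l => eulerCoeff p l * (a * p) ^ l * eulerInvCoeff p (m + 1 + l)) 1
  rw [besselKernel, besselKernel, besselKernel, ← hshift, ← tsum_mul_left,
    ← Summable.tsum_sub hs (hs'.mul_left a)]
  refine tsum_congr fun l => ?_
  have h1 := eulerCoeff_rec hp0 hp1 l
  have h2 : a ^ l = a * a ^ (l - 1) := by rw [← zpow_one_add₀ ha.ne']; congr 1; ring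
  rw [show m + 1 + (l - 1) = m + l by ring, mul_zpow, mul_zpow, h2]
  linear_combination a * a ^ (l - 1) * eulerInvCoeff p (m + l) * h1

theorem sum_range_besselKernel {a p : ℝ} (ha : 0 < a) (hp0 : 0 < p) (hp1 : p < 1) (i : ℤ) (L : ℕ) :
    ∑ j ∈ Finset.range L, a ^ j * besselKernel a p (i + j) =
      besselKernel (a * p) p i - a ^ L * besselKernel (a * p) p (i + L) := by
  induction L with
  | zero => simp
  | succ L ih =>
    rw [Finset.sum_range_succ, ih, besselKernel_eq_sub ha hp0 hp1 (i + L)]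
    push_cast
    rw [add_assoc i]
    ring

/-- Expand `(a p ^ k; p)_∞` by Euler and sum over `k` first: the inner sum is `(p ^ (m+l+1); p)_∞`,
which is `(p; p)_∞` times a coefficient of `1 / (z; p)_∞`. -/
theorem tsum_eulerSeries_eq_besselKernel {a p : ℝ} (ha : 0 < a) (hp0 : 0 < p) (hp1 : p < 1)
    (m : ℤ) : ∑' k : ℤ, eulerCoeff p k * (p ^ (m + 1)) ^ k * eulerSeries p (a * p ^ k) =
      eulerSeries p p * besselKernel a p m := by
  have hpm := zpow_pos hp0 (m + 1)
  have hswap : ∑' k : ℤ, ∑' l : ℤ,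
        eulerCoeff p k * (p ^ (m + 1)) ^ k * (eulerCoeff p l * (a * p ^ k) ^ l) =
      ∑' l : ℤ, ∑' k : ℤ,
        eulerCoeff p k * (p ^ (m + 1)) ^ k * (eulerCoeff p l * (a * p ^ k) ^ l) := by
    refine tsum_comm_of_norm_le (eulerCoeff_summable hp0 hp1 hpm) (eulerCoeff_summable hp0 hp1 ha)
      (fun k => by positivity) (fun l => by positivity) fun k l => ?_
    by_cases hk : k < 0
    · simp [eulerCoeff_of_neg p hk]
    by_cases hl : l < 0
    · simp [eulerCoeff_of_neg p hl]
    have h1 : a * p ^ k ≤ a := by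
      refine mul_le_of_le_one_right ha.le ?_
      lift k to ℕ using not_lt.1 hk
      rw [zpow_natCast]
      exact pow_le_one₀ hp0.le hp1.le
    have h2 := zpow_le_zpow_left₀ (not_lt.1 hl) (by positivity) h1
    have h3 : 0 < a * p ^ k := by positivity
    rw [norm_mul, norm_mul, norm_mul, Real.norm_of_nonneg (zpow_pos hpm k).le,
      Real.norm_of_nonneg (zpow_pos h3 l).le, Real.norm_eq_abs, Real.norm_eq_abs]
    gcongr
  have hinner : ∀ l : ℤ, ∑' k : ℤ,
        eulerCoeff p k * (p ^ (m + 1)) ^ k * (eulerCoeff p l * (a * p ^ k) ^ l) =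
      eulerSeries p p * (eulerCoeff p l * a ^ l * eulerInvCoeff p (m + l)) := fun l => by
    have h : ∀ k : ℤ, eulerCoeff p k * (p ^ (m + 1)) ^ k * (eulerCoeff p l * (a * p ^ k) ^ l) =
        eulerCoeff p l * a ^ l * (eulerCoeff p k * (p ^ (m + l + 1)) ^ k) := fun k => by
      have h2 : (p ^ (m + l + 1)) ^ k = (p ^ (m + 1)) ^ k * (p ^ k) ^ l := by
        rw [← zpow_mul, ← zpow_mul, ← zpow_mul, ← zpow_add₀ hp0.ne']; congr 1; ring
      rw [mul_zpow, h2]; ring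
    rw [tsum_congr h, tsum_mul_left, ← eulerSeries, ← eulerInvCoeff_mul_eulerSeries hp0 hp1]
    ring
  simp only [eulerSeries] at hinner hswap ⊢
  simp only [← tsum_mul_left]
  rw [hswap, tsum_congr hinner, besselKernel, ← tsum_mul_left]

theorem qPochInf_mul_qBesselJ {v q : ℝ} (hv : -1 < v) (hq0 : 0 < q) (hq1 : q < 1) (m : ℤ) :
    qPochInf (q ^ (2 * v + 2)) (q ^ 2) / qPochInf (q ^ 2) (q ^ 2) * qBesselJ v (q ^ m) (q ^ 2) =
      besselKernel (q ^ (2 * v + 2)) (q ^ 2) m := by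
  set p := q ^ 2 with hp
  set a := q ^ (2 * v + 2) with ha
  have hp0 : 0 < p := by positivity
  have hp1 : p < 1 := pow_lt_one₀ hq0.le hq1 two_ne_zero
  have ha0 : 0 < a := Real.rpow_pos_of_pos hq0 _
  have ha1 : a < 1 := Real.rpow_lt_one hq0.le hq1 (by linarith)
  have hpa : p ^ (v + 1) = a := by
    rw [hp, ha, ← Real.rpow_natCast, ← Real.rpow_mul hq0.le]; congr 1; push_cast; ring
  have hPp := qPochInf_pos hp0 hp1 hp0 hp1
  have h := tsum_eulerSeries_eq_besselKernel ha0 hp0 hp1 m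
  rw [eulerSeries_eq_qPochInf hp0 hp1 hp0, ← tsum_int_eq_nat (fun k hk => by
    rw [eulerCoeff_of_neg p hk, zero_mul, zero_mul])] at h
  rw [div_mul_eq_mul_div, div_eq_iff hPp.ne', mul_comm (besselKernel a p m), ← h, qBesselJ,
    ← tsum_mul_left]
  refine tsum_congr fun k => ?_
  -- The quotient `(a; p)_∞ / (a; p)_k = (a p ^ k; p)_∞` absorbs the second denominator of the
  -- Bessel series.
  have h1 := eulerSeries_eq_qPoch_mul hp0 hp1 ha0 k
  have h2 := (qPoch_pos ha0 ha1 hp0 hp1 k).ne'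
  have h3 := (qPoch_pos hp0 hp1 hp0 hp1 k).ne'
  rw [eulerSeries_eq_qPochInf hp0 hp1 ha0] at h1
  have h4 : k * (k + 1) / 2 = k.choose 2 + k := by
    have := Nat.choose_two_right (k + 1)
    rw [Nat.add_sub_cancel, mul_comm] at this
    rw [← this, Nat.choose_succ_succ' k 1, Nat.choose_one_right, add_comm]
  have h5 : (q ^ m) ^ (2 * k) = (p ^ m) ^ k := by
    rw [pow_mul, hp, ← zpow_natCast (q ^ m) 2, ← zpow_natCast q 2, ← zpow_mul, ← zpow_mul, mul_comm]
  rw [eulerCoeff_natCast, zpow_natCast, zpow_natCast, h1, hpa, h4, h5, zpow_add_one₀ hp0.ne',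
    pow_add, mul_pow]
  field_simp

/-! ### The transform on exponents and its inversion. -/

/-- The `q`-Bessel Fourier transform, written on the exponents of `ℝ_q^+`. -/
noncomputable def besselTransform (a p : ℝ) (f : ℤ → ℂ) (n : ℤ) : ℂ :=
  ∑' m : ℤ, f m * ((besselKernel a p (n + m) * a ^ m : ℝ) : ℂ)

theorem besselKernel_shift_summable {a b p : ℝ} (ha : 0 < a) (hb0 : 0 < b) (hb1 : b < 1)
    (hp0 : 0 < p) (hp1 : p < 1) (n : ℤ) :
    Summable fun m : ℤ => |besselKernel a p (n + m)| * b ^ m := by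
  have h := (summable_int_sub (besselKernel_weighted_summable ha hb0 hb1 hp0 hp1)
    (-n)).mul_right (b ^ (-n))
  refine h.congr fun m => ?_
  rw [sub_neg_eq_add, mul_assoc, ← zpow_add₀ hb0.ne', add_neg_cancel_right, add_comm]

theorem tsum_besselKernel_shift {a b p : ℝ} (hb0 : 0 < b) (n : ℤ) :
    ∑' m : ℤ, |besselKernel a p (n + m)| * b ^ m =
      (∑' m : ℤ, |besselKernel a p m| * b ^ m) * b ^ (-n) := by
  rw [← tsum_mul_right, ← tsum_int_sub (fun m => |besselKernel a p (n + m)| * b ^ m) n]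
  refine tsum_congr fun m => ?_
  rw [add_sub_cancel, sub_eq_add_neg, zpow_add₀ hb0.ne', mul_assoc]

theorem exists_norm_besselTransform_le {a p : ℝ} (ha0 : 0 < a) (hp0 : 0 < p) (hp1 : p < 1)
    {f : ℤ → ℂ} (hf : Summable fun m => ‖f m‖ * a ^ m) :
    ∃ B, 0 ≤ B ∧ ∀ n, ‖besselTransform a p f n‖ ≤ B := by
  obtain ⟨M, hM0, hM⟩ := exists_abs_besselKernel_le ha0 hp0 hp1
  have h : ∀ n, ‖besselTransform a p f n‖ ≤ ∑' m, ‖f m‖ * a ^ m * M := fun n =>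
    tsum_of_norm_bounded (hf.mul_right M).hasSum fun m => by
      rw [norm_mul, Complex.norm_real, norm_mul, Real.norm_of_nonneg (zpow_pos ha0 m).le,
        Real.norm_eq_abs, mul_assoc, mul_comm (a ^ m)]
      exact mul_le_mul_of_nonneg_left (mul_le_mul_of_nonneg_right (hM _) (by positivity))
        (norm_nonneg _)
  exact ⟨_, (norm_nonneg _).trans (h 0), h⟩

theorem besselTransform_besselTransform {a p : ℝ} (ha0 : 0 < a) (ha1 : a < 1) (hp0 : 0 < p)
    (hp1 : p < 1) {f : ℤ → ℂ} (hf : Summable fun m => ‖f m‖ * a ^ m) (l : ℤ) :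
    besselTransform a p (besselTransform a p f) l = f l := by
  obtain ⟨M, hM0, hM⟩ := exists_abs_besselKernel_le ha0 hp0 hp1
  have hswap : ∑' n : ℤ, ∑' m : ℤ, f m * ((besselKernel a p (n + m) * a ^ m : ℝ) : ℂ) *
        ((besselKernel a p (l + n) * a ^ n : ℝ) : ℂ) =
      ∑' m : ℤ, ∑' n : ℤ, f m * ((besselKernel a p (n + m) * a ^ m : ℝ) : ℂ) *
        ((besselKernel a p (l + n) * a ^ n : ℝ) : ℂ) := by
    refine (tsum_comm_of_norm_le (hf.mul_right M)
      (besselKernel_shift_summable ha0 ha0 ha1 hp0 hp1 l) (fun m => by positivity)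
      (fun n => by positivity) fun m n => ?_).symm
    rw [norm_mul, norm_mul, Complex.norm_real, Complex.norm_real, norm_mul, norm_mul,
      Real.norm_of_nonneg (zpow_pos ha0 m).le, Real.norm_of_nonneg (zpow_pos ha0 n).le,
      Real.norm_eq_abs, Real.norm_eq_abs, mul_assoc ‖f m‖ (a ^ m) M,
      mul_comm (a ^ m) M]
    gcongr
    exact hM _
  have hinner : ∀ m : ℤ, ∑' n : ℤ, f m * ((besselKernel a p (n + m) * a ^ m : ℝ) : ℂ) *
        ((besselKernel a p (l + n) * a ^ n : ℝ) : ℂ) = if m = l then f m else 0 := fun m => by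
    have h : ∀ n : ℤ, f m * ((besselKernel a p (n + m) * a ^ m : ℝ) : ℂ) *
        ((besselKernel a p (l + n) * a ^ n : ℝ) : ℂ) = f m * ((a ^ m : ℝ) : ℂ) *
        ((besselKernel a p (m + n) * besselKernel a p (l + n) * a ^ n : ℝ) : ℂ) := fun n => by
      rw [add_comm n m]; push_cast; ring
    rw [tsum_congr h, tsum_mul_left, ← Complex.ofReal_tsum,
      besselKernel_orthogonality ha0 ha1 hp0 hp1]
    split_ifs with hm
    · rw [hm, mul_assoc, ← Complex.ofReal_mul, ← zpow_add₀ ha0.ne']; simp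
    · simp
  rw [besselTransform]
  simp only [besselTransform, ← tsum_mul_right]
  rw [hswap, tsum_congr hinner, tsum_ite_eq]

/-! ### Positivity from quadratic forms. -/

/-- If `∑ g(t) |h(t)|² a^t ≥ 0` for all finite real combinations `h` of the functions `K(x + ·)`,
then the bounded function `g` is nonnegative: such combinations approximate point masses. -/
theorem nonneg_of_quadratic_form_nonneg {a p : ℝ} (ha0 : 0 < a) (ha1 : a < 1) (hp0 : 0 < p)
    (hp1 : p < 1) {g : ℤ → ℂ} {B : ℝ} (hB : ∀ n, ‖g n‖ ≤ B)
    (hg : ∀ (s : Finset ℤ) (z : ℤ → ℝ),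
      0 ≤ ∑' t : ℤ, g t * (((∑ x ∈ s, z x * besselKernel a p (x + t)) ^ 2 * a ^ t : ℝ) : ℂ))
    (u : ℤ) : 0 ≤ g u := by
  obtain ⟨M, hM0, hM⟩ := exists_abs_besselKernel_le ha0 hp0 hp1
  have hB0 : 0 ≤ B := (norm_nonneg _).trans (hB 0)
  set S := ∑' m : ℤ, |besselKernel a p m| * a ^ m with hS
  have hS0 : 0 ≤ S := tsum_nonneg fun m => by positivity
  -- With these coefficients the full sum over `x` is the orthogonality relation, so `h s` tends
  -- pointwise to `a ^ (-u)` times the indicator of `u`.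
  let z : ℤ → ℝ := fun x => besselKernel a p (x + u) * a ^ x
  let h : Finset ℤ → ℤ → ℝ := fun s t => ∑ x ∈ s, z x * besselKernel a p (x + t)
  have hterm : ∀ t x, ‖z x * besselKernel a p (x + t)‖ ≤ |besselKernel a p (u + x)| * a ^ x * M ∧
      ‖z x * besselKernel a p (x + t)‖ ≤ |besselKernel a p (t + x)| * a ^ x * M := fun t x => by
    have hx := zpow_pos ha0 x
    have e : ‖z x * besselKernel a p (x + t)‖ =
        |besselKernel a p (u + x)| * a ^ x * |besselKernel a p (t + x)| := by
      rw [norm_mul, norm_mul, Real.norm_of_nonneg hx.le, Real.norm_eq_abs, Real.norm_eq_abs,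
        add_comm x u, add_comm x t]
    rw [e]
    refine ⟨mul_le_mul_of_nonneg_left (hM _) (by positivity), ?_⟩
    nlinarith [mul_le_mul_of_nonneg_left (hM (u + x))
      (mul_nonneg hx.le (abs_nonneg (besselKernel a p (t + x))))]
  have hsum := fun n => besselKernel_shift_summable ha0 ha0 ha1 hp0 hp1 n
  -- Two bounds uniform in `s`: the first makes `h² a ^ t` decay as `t → ∞`, the second as `t → -∞`.
  -- Together they give a majorant of order `a ^ |t|`.
  have hb : ∀ s t, |h s t| ≤ S * a ^ (-u) * M ∧ |h s t| ≤ S * a ^ (-t) * M := fun s t => by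
    constructor
    · rw [hS, ← tsum_besselKernel_shift ha0, ← tsum_mul_right]
      refine (Finset.abs_sum_le_sum_abs _ _).trans
        ((Finset.sum_le_sum fun x _ => (hterm t x).1).trans ?_)
      exact ((hsum u).mul_right M).sum_le_tsum s fun x _ => by positivity
    · rw [hS, ← tsum_besselKernel_shift ha0, ← tsum_mul_right]
      refine (Finset.abs_sum_le_sum_abs _ _).trans
        ((Finset.sum_le_sum fun x _ => (hterm t x).2).trans ?_)
      exact ((hsum t).mul_right M).sum_le_tsum s fun x _ => by positivity
  have hlim : ∀ t, Tendsto (fun s => h s t) atTop (𝓝 (if t = u then a ^ (-u) else 0)) := fun t => by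
    have hs : Summable fun x => z x * besselKernel a p (x + t) :=
      Summable.of_norm_bounded ((hsum u).mul_right M) fun x => (hterm t x).1
    have e : ∑' x, z x * besselKernel a p (x + t) = if t = u then a ^ (-u) else 0 := by
      rw [← besselKernel_orthogonality ha0 ha1 hp0 hp1]
      refine tsum_congr fun x => ?_
      rw [add_comm t x, add_comm u x]; ring
    rw [← e]
    exact hs.hasSum
  have hdom : Tendsto (fun s => ∑' t : ℤ, g t * ((h s t ^ 2 * a ^ t : ℝ) : ℂ)) atTop
      (𝓝 (∑' t : ℤ, g t * (((if t = u then a ^ (-u) else 0) ^ 2 * a ^ t : ℝ) : ℂ))) := by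
    have hbd : Summable fun t : ℤ => B * ((S * M) ^ 2 * ((a ^ (-u)) ^ 2 + 1) * a ^ |t|) := by
      refine Summable.mul_left _ (Summable.mul_left _ ?_)
      have hn : Summable fun n : ℕ => a ^ |(n : ℤ)| := by
        simpa using summable_geometric_of_lt_one ha0.le ha1
      exact Summable.of_nat_of_neg hn (by simpa using hn)
    refine tendsto_tsum_of_dominated_convergence hbd (fun t => ?_)
      (Eventually.of_forall fun s t => ?_)
    · exact ((Complex.continuous_ofReal.tendsto _).comp
        (((hlim t).pow 2).mul_const (a ^ t))).const_mul (g t)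
    · have ht := zpow_pos ha0 t
      rw [norm_mul, Complex.norm_real, Real.norm_of_nonneg (by positivity)]
      refine mul_le_mul (hB t) ?_ (by positivity) hB0
      have hSM : 0 ≤ (S * M) ^ 2 := sq_nonneg _
      rcases le_total 0 t with h0 | h0
      · rw [abs_of_nonneg h0]
        refine mul_le_mul_of_nonneg_right ?_ ht.le
        have h1 := pow_le_pow_left₀ (abs_nonneg _) (hb s t).1 2
        rw [sq_abs] at h1
        nlinarith
      · rw [abs_of_nonpos h0]
        have h1 := pow_le_pow_left₀ (abs_nonneg _) (hb s t).2 2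
        rw [sq_abs] at h1
        have h2 : (S * a ^ (-t) * M) ^ 2 * a ^ t = (S * M) ^ 2 * a ^ (-t) := by
          rw [zpow_neg]; field_simp
        have h3 := mul_le_mul_of_nonneg_right h1 ht.le
        rw [h2] at h3
        refine h3.trans (mul_le_mul_of_nonneg_right ?_ (zpow_pos ha0 _).le)
        nlinarith [sq_nonneg (a ^ (-u))]
  have hval : ∑' t : ℤ, g t * (((if t = u then a ^ (-u) else 0) ^ 2 * a ^ t : ℝ) : ℂ) =
      g u * ((a ^ (-u) : ℝ) : ℂ) := by
    rw [tsum_eq_single u fun t ht => by simp [ht], if_pos rfl]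
    congr 2
    rw [sq, mul_assoc, ← zpow_add₀ ha0.ne', neg_add_cancel, zpow_zero, mul_one]
  rw [hval] at hdom
  have h0 : 0 ≤ g u * ((a ^ (-u) : ℝ) : ℂ) := ge_of_tendsto' hdom fun s => hg s z
  have h1 : (0 : ℂ) ≤ ((a ^ u : ℝ) : ℂ) := Complex.zero_le_real.2 (zpow_pos ha0 u).le
  have h2 := mul_nonneg h0 h1
  rwa [mul_assoc, ← Complex.ofReal_mul, ← zpow_add₀ ha0.ne', neg_add_cancel, zpow_zero,
    Complex.ofReal_one, mul_one] at h2

/-! ### Integrability of a nonnegative transform. -/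

/-- A nonnegative transform of a bounded function of `ℓ¹` lies in `ℓ¹`. -/
theorem besselTransform_summable {a p : ℝ} (ha0 : 0 < a) (ha1 : a < 1) (hp0 : 0 < p)
    (hp1 : p < 1) {f : ℤ → ℂ} {B : ℝ} (hB : ∀ n, ‖f n‖ ≤ B)
    (hf : Summable fun m => ‖f m‖ * a ^ m) (hpos : ∀ n, 0 ≤ besselTransform a p f n) :
    Summable fun n => ‖besselTransform a p f n‖ * a ^ n := by
  have hB0 : 0 ≤ B := (norm_nonneg _).trans (hB 0)
  have hap := mul_pos ha0 hp0
  obtain ⟨M, hM0, hM⟩ := exists_abs_besselKernel_le ha0 hp0 hp1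
  set S := ∑' m : ℤ, |besselKernel (a * p) p m| * a ^ m with hS
  have hfs : ∀ n, Summable fun m : ℤ => f m * ((besselKernel a p (n + m) * a ^ m : ℝ) : ℂ) :=
    fun n => Summable.of_norm_bounded (hf.mul_right M) fun m => by
      rw [norm_mul, Complex.norm_real, norm_mul, Real.norm_of_nonneg (zpow_pos ha0 m).le,
        Real.norm_eq_abs, mul_assoc, mul_comm (a ^ m)]
      exact mul_le_mul_of_nonneg_left (mul_le_mul_of_nonneg_right (hM _) (by positivity))
        (norm_nonneg _)
  have hshift := fun n => besselKernel_shift_summable hap ha0 ha1 hp0 hp1 n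
  -- The bound is uniform in `N` and `L`: each of the two kernels left by telescoping contributes
  -- `S`, because `a ^ N` or `a ^ (N + L)` cancels the cost of the shift.
  have hblock : ∀ (N : ℤ) (L : ℕ),
      ∑ j ∈ Finset.range L, ‖besselTransform a p f (N + j)‖ * a ^ (N + j) ≤ B * (2 * S) := by
    intro N L
    have e1 : ((∑ j ∈ Finset.range L, ‖besselTransform a p f (N + j)‖ * a ^ (N + j) : ℝ) : ℂ) =
        ∑' m : ℤ, f m * ((a ^ m * (a ^ N * (besselKernel (a * p) p (N + m) -
          a ^ L * besselKernel (a * p) p (N + m + L))) : ℝ) : ℂ) := by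
      have : ∀ j ∈ Finset.range L,
          ((‖besselTransform a p f (N + j)‖ * a ^ (N + (j : ℤ)) : ℝ) : ℂ) =
          ∑' m : ℤ, f m * ((besselKernel a p (N + j + m) * a ^ m : ℝ) : ℂ) *
            ((a ^ (N + (j : ℤ)) : ℝ) : ℂ) := fun j _ => by
        rw [Complex.ofReal_mul, ← Complex.eq_coe_norm_of_nonneg (hpos _), besselTransform,
          tsum_mul_right]
      rw [Complex.ofReal_sum, Finset.sum_congr rfl this,
        ← Summable.tsum_finsetSum fun j _ => (hfs _).mul_right _]
      refine tsum_congr fun m => ?_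
      rw [← sum_range_besselKernel ha0 hp0 hp1, Finset.mul_sum, Finset.mul_sum, Complex.ofReal_sum,
        Finset.mul_sum]
      refine Finset.sum_congr rfl fun j _ => ?_
      rw [zpow_add₀ ha0.ne', zpow_natCast, show N + j + m = N + m + j by ring]
      push_cast
      ring
    have hbd := (((hshift N).mul_right (a ^ N)).add
      ((hshift (N + L)).mul_right (a ^ (N + L)))).mul_left B
    have hval : ∑' m : ℤ, B * (|besselKernel (a * p) p (N + m)| * a ^ m * a ^ N +
        |besselKernel (a * p) p (N + L + m)| * a ^ m * a ^ (N + (L : ℤ))) = B * (2 * S) := by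
      rw [tsum_mul_left, Summable.tsum_add ((hshift N).mul_right _) ((hshift (N + L)).mul_right _),
        tsum_mul_right, tsum_mul_right, tsum_besselKernel_shift ha0, tsum_besselKernel_shift ha0,
        mul_assoc, mul_assoc, ← zpow_add₀ ha0.ne', ← zpow_add₀ ha0.ne', neg_add_cancel,
        neg_add_cancel, zpow_zero, mul_one, two_mul]
    have hnn : 0 ≤ ∑ j ∈ Finset.range L, ‖besselTransform a p f (N + j)‖ * a ^ (N + (j : ℤ)) :=
      Finset.sum_nonneg fun j _ => by positivity
    rw [← Real.norm_of_nonneg hnn, ← Complex.norm_real, e1, ← hval]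
    refine tsum_of_norm_bounded hbd.hasSum fun m => ?_
    rw [norm_mul, Complex.norm_real, norm_mul, norm_mul, Real.norm_of_nonneg (zpow_pos ha0 m).le,
      Real.norm_of_nonneg (zpow_pos ha0 N).le]
    refine mul_le_mul (hB m) ?_ (by positivity) hB0
    have h1 : ‖besselKernel (a * p) p (N + m) - a ^ L * besselKernel (a * p) p (N + m + L)‖ ≤
        |besselKernel (a * p) p (N + m)| + a ^ L * |besselKernel (a * p) p (N + L + m)| := by
      refine (norm_sub_le _ _).trans_eq ?_
      rw [norm_mul, Real.norm_of_nonneg (pow_pos ha0 L).le, Real.norm_eq_abs, Real.norm_eq_abs,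
        show N + m + L = N + L + m by ring]
    have h2 := mul_le_mul_of_nonneg_left h1 (mul_pos (zpow_pos ha0 m) (zpow_pos ha0 N)).le
    rw [zpow_add₀ ha0.ne', zpow_natCast]
    linarith
  refine summable_of_sum_le (c := B * (2 * S)) (fun n => by positivity) fun s => ?_
  obtain ⟨N, hN⟩ : ∃ N : ℕ, ∀ n ∈ s, n.natAbs < N :=
    ⟨s.sup Int.natAbs + 1, fun n hn => Nat.lt_succ_of_le (Finset.le_sup (f := Int.natAbs) hn)⟩
  refine le_trans ?_ (hblock (-N) (2 * N))
  have hinj : Function.Injective fun j : ℕ => -(N : ℤ) + j := fun i j h => by simpa using h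
  rw [← Finset.sum_image (s := Finset.range (2 * N)) (g := fun j : ℕ => -(N : ℤ) + j)
    (f := fun n => ‖besselTransform a p f n‖ * a ^ n) hinj.injOn]
  refine Finset.sum_le_sum_of_subset_of_nonneg (fun n hn => ?_) fun n _ _ => by positivity
  have := hN n hn
  exact Finset.mem_image.2 ⟨(n + N).toNat, Finset.mem_range.2 (by omega), by omega⟩

/-! ### Passage from `ℝ_q^+` to exponents, and the conclusion. -/

theorem qReals_eq_qPoint {q : ℝ} (x : qReals q) : ∃ n : ℤ, x = qPoint q n := by
  obtain ⟨x, n, rfl⟩ := x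
  exact ⟨n, rfl⟩

theorem zpow_mul_zpow_rpow {v q : ℝ} (hq0 : 0 < q) (n : ℤ) :
    q ^ n * (q ^ n) ^ (2 * v + 1) = (q ^ (2 * v + 2)) ^ n := by
  rw [← Real.rpow_intCast q n, ← Real.rpow_intCast _ n, ← Real.rpow_mul hq0.le,
    ← Real.rpow_mul hq0.le, ← Real.rpow_add hq0]
  congr 1
  ring

theorem memLq1_iff {v q : ℝ} (hq0 : 0 < q) (f : qReals q → ℂ) :
    MemLq1 q v f ↔ Summable fun n : ℤ => ‖f (qPoint q n)‖ * (q ^ (2 * v + 2)) ^ n :=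
  summable_congr fun n => by rw [← zpow_mul_zpow_rpow hq0]; ring

theorem qBesselConst_mul_jacksonIntegral {v q : ℝ} (hq0 : 0 < q) (hq1 : q < 1)
    (g : qReals q → ℂ) :
    (qBesselConst q v : ℂ) * jacksonIntegral q (fun t =>
        g t * (((t : ℝ) ^ (2 * v + 1) : ℝ) : ℂ)) =
      ∑' n : ℤ, ((qPochInf (q ^ (2 * v + 2)) (q ^ 2) / qPochInf (q ^ 2) (q ^ 2) : ℝ) : ℂ) *
        g (qPoint q n) * (((q ^ (2 * v + 2)) ^ n : ℝ) : ℂ) := by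
  have h1 : 1 - q ≠ 0 := (sub_pos.2 hq1).ne'
  rw [jacksonIntegral, ← mul_assoc, ← Complex.ofReal_mul, qBesselConst, mul_right_comm,
    one_div_mul_cancel h1, one_mul, ← tsum_mul_left]
  refine tsum_congr fun n => ?_
  rw [← zpow_mul_zpow_rpow hq0]
  simp only [qPoint]
  push_cast
  ring

theorem qBesselFourier_qPoint {v q : ℝ} (hv : -1 < v) (hq0 : 0 < q) (hq1 : q < 1)
    (f : qReals q → ℂ) (n : ℤ) :
    qBesselFourier q v f (qPoint q n) =
      besselTransform (q ^ (2 * v + 2)) (q ^ 2) (fun m => f (qPoint q m)) n := by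
  rw [qBesselFourier, qBesselConst_mul_jacksonIntegral hq0 hq1, besselTransform]
  refine tsum_congr fun m => ?_
  rw [← qPochInf_mul_qBesselJ hv hq0 hq1, zpow_add₀ hq0.ne']
  simp only [qPoint]
  push_cast
  ring

/-- The translation carries one normalizing constant but two Bessel functions; the extra positive
factor turns both into kernels. -/
theorem qTranslation_qPoint {v q : ℝ} (hv : -1 < v) (hq0 : 0 < q) (hq1 : q < 1)
    (f : qReals q → ℂ) (x y : ℤ) :
    ((qPochInf (q ^ (2 * v + 2)) (q ^ 2) / qPochInf (q ^ 2) (q ^ 2) : ℝ) : ℂ) *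
        qTranslation q v (qPoint q x) f (qPoint q y) =
      ∑' t : ℤ, qBesselFourier q v f (qPoint q t) *
        ((besselKernel (q ^ (2 * v + 2)) (q ^ 2) (x + t) *
          besselKernel (q ^ (2 * v + 2)) (q ^ 2) (y + t) * (q ^ (2 * v + 2)) ^ t : ℝ) : ℂ) := by
  rw [qTranslation, qBesselConst_mul_jacksonIntegral hq0 hq1, ← tsum_mul_left]
  refine tsum_congr fun t => ?_
  rw [← qPochInf_mul_qBesselJ hv hq0 hq1, ← qPochInf_mul_qBesselJ hv hq0 hq1, zpow_add₀ hq0.ne',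
    zpow_add₀ hq0.ne']
  simp only [qPoint]
  push_cast
  ring

/-- The transform of a function of `q`-positive type is nonnegative. -/
theorem IsQPositiveType.qBesselFourier_nonneg {v q : ℝ} (hv : -1 < v) (hq0 : 0 < q) (hq1 : q < 1)
    {φ : qReals q → ℂ} (hφ : IsQPositiveType q v φ) (n : ℤ) :
    0 ≤ qBesselFourier q v φ (qPoint q n) := by
  set p := q ^ 2 with hp
  set a := q ^ (2 * v + 2) with ha
  have hp0 : 0 < p := by positivity
  have hp1 : p < 1 := pow_lt_one₀ hq0.le hq1 two_ne_zero
  have ha0 : 0 < a := Real.rpow_pos_of_pos hq0 _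
  have ha1 : a < 1 := Real.rpow_lt_one hq0.le hq1 (by linarith)
  obtain ⟨M, hM0, hM⟩ := exists_abs_besselKernel_le ha0 hp0 hp1
  obtain ⟨B, hB0, hB⟩ := exists_norm_besselTransform_le ha0 hp0 hp1
    ((memLq1_iff hq0 φ).1 hφ.memLq1)
  replace hB : ∀ n, ‖qBesselFourier q v φ (qPoint q n)‖ ≤ B := fun n => by
    rw [qBesselFourier_qPoint hv hq0 hq1]
    exact hB n
  refine nonneg_of_quadratic_form_nonneg ha0 ha1 hp0 hp1
    (g := fun n => qBesselFourier q v φ (qPoint q n)) hB (fun s z => ?_) n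
  have hc : (0 : ℂ) ≤ ((qPochInf a p / qPochInf p p : ℝ) : ℂ) := Complex.zero_le_real.2
    (div_pos (qPochInf_pos ha0 ha1 hp0 hp1) (qPochInf_pos hp0 hp1 hp0 hp1)).le
  -- Real coefficients suffice: the double sum then collapses to the square of a real combination of
  -- kernels.
  have h := mul_nonneg hc (hφ.posDef s.card (fun i => (z (s.equivFin.symm i) : ℂ))
    fun i => qPoint q (s.equivFin.symm i : ℤ))
  have hsum : ∀ x y : ℤ, Summable fun t : ℤ => qBesselFourier q v φ (qPoint q t) *
      ((besselKernel a p (x + t) * besselKernel a p (y + t) * a ^ t : ℝ) : ℂ) := fun x y => by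
    refine Summable.of_norm_bounded
      ((besselKernel_shift_summable ha0 ha0 ha1 hp0 hp1 y).mul_left (B * M)) fun t => ?_
    rw [norm_mul, Complex.norm_real, norm_mul, norm_mul, Real.norm_of_nonneg (zpow_pos ha0 t).le,
      Real.norm_eq_abs, Real.norm_eq_abs, mul_assoc B, mul_assoc |besselKernel a p (x + t)|]
    gcongr
    · exact hB t
    · exact hM _
  have hreindex : ∀ F : ℤ → ℂ, ∑ i : Fin s.card, F (s.equivFin.symm i) = ∑ x ∈ s, F x := fun F => by
    rw [← Finset.sum_coe_sort s F]
    exact s.equivFin.symm.sum_comp fun x => F x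
  convert h using 1
  rw [hreindex fun x => ∑ l : Fin s.card, (z x : ℂ) *
    (starRingEnd ℂ) (z (s.equivFin.symm l) : ℂ) *
      qTranslation q v (qPoint q x) φ (qPoint q (s.equivFin.symm l : ℤ))]
  have hinner : ∀ x ∈ s, ∑ l : Fin s.card, (z x : ℂ) *
      (starRingEnd ℂ) (z (s.equivFin.symm l) : ℂ) *
        qTranslation q v (qPoint q x) φ (qPoint q (s.equivFin.symm l : ℤ)) =
      ∑ y ∈ s, (z x : ℂ) * (z y : ℂ) * qTranslation q v (qPoint q x) φ (qPoint q y) := fun x _ => by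
    simp only [Complex.conj_ofReal]
    exact hreindex fun y => (z x : ℂ) * (z y : ℂ) * qTranslation q v (qPoint q x) φ (qPoint q y)
  have hxy : ∀ x y : ℤ, ((qPochInf a p / qPochInf p p : ℝ) : ℂ) *
      ((z x : ℂ) * (z y : ℂ) * qTranslation q v (qPoint q x) φ (qPoint q y)) =
      ∑' t : ℤ, (z x : ℂ) * (z y : ℂ) * (qBesselFourier q v φ (qPoint q t) *
        ((besselKernel a p (x + t) * besselKernel a p (y + t) * a ^ t : ℝ) : ℂ)) := fun x y => by
    rw [mul_left_comm, qTranslation_qPoint hv hq0 hq1, tsum_mul_left]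
  rw [Finset.sum_congr rfl hinner]
  simp only [Finset.mul_sum, hxy]
  have hs2 : ∀ x ∈ s, ∀ y ∈ s, Summable fun t : ℤ => (z x : ℂ) * (z y : ℂ) *
      (qBesselFourier q v φ (qPoint q t) *
        ((besselKernel a p (x + t) * besselKernel a p (y + t) * a ^ t : ℝ) : ℂ)) :=
    fun x _ y _ => (hsum x y).mul_left _
  rw [Finset.sum_congr rfl fun x hx => (Summable.tsum_finsetSum (hs2 x hx)).symm,
    ← Summable.tsum_finsetSum fun x hx => summable_sum (hs2 x hx)]
  refine tsum_congr fun t => ?_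
  rw [sq, Finset.sum_mul_sum]
  push_cast
  rw [Finset.sum_mul, Finset.mul_sum]
  refine Finset.sum_congr rfl fun x _ => ?_
  rw [Finset.sum_mul, Finset.mul_sum]
  refine Finset.sum_congr rfl fun y _ => ?_
  ring

theorem corollary2 (v : ℝ) (hv : -1 < v) (q : ℝ) (hq : q ∈ positivitySet v)
    (φ : qReals q → ℂ) (hφ : IsQPositiveType q v φ) :
    ∃ ξ : qReals q → ℂ, (∀ x, 0 ≤ ξ x) ∧ ξ ∈ qWienerAlgebra q v ∧
      (∀ x, φ x = qBesselFourier q v ξ x) ∧ ξ = qBesselFourier q v φ := by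
  obtain ⟨hq0, hq1, -⟩ := hq
  have hp0 : 0 < q ^ 2 := by positivity
  have hp1 : q ^ 2 < 1 := pow_lt_one₀ hq0.le hq1 two_ne_zero
  have ha0 : 0 < q ^ (2 * v + 2) := Real.rpow_pos_of_pos hq0 _
  have ha1 : q ^ (2 * v + 2) < 1 := Real.rpow_lt_one hq0.le hq1 (by linarith)
  have hpos := hφ.qBesselFourier_nonneg hv hq0 hq1
  have hL1 := (memLq1_iff hq0 φ).1 hφ.memLq1
  obtain ⟨⟨C, hC⟩, -⟩ := hφ.memCqb
  have hinv : ∀ x, φ x = qBesselFourier q v (qBesselFourier q v φ) x := fun x => by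
    obtain ⟨n, rfl⟩ := qReals_eq_qPoint x
    rw [qBesselFourier_qPoint hv hq0 hq1]
    simp only [qBesselFourier_qPoint hv hq0 hq1]
    exact (besselTransform_besselTransform ha0 ha1 hp0 hp1 hL1 n).symm
  refine ⟨qBesselFourier q v φ, fun x => ?_, ⟨?_, ?_⟩, hinv, rfl⟩
  · obtain ⟨n, rfl⟩ := qReals_eq_qPoint x
    exact hpos n
  · simp only [qBesselFourier_qPoint hv hq0 hq1] at hpos
    rw [memLq1_iff hq0]
    simp only [qBesselFourier_qPoint hv hq0 hq1]
    exact besselTransform_summable ha0 ha1 hp0 hp1 (fun n => hC _) hL1 hpos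
  -- By inversion the transform of `ξ` is `φ` itself.
  · rw [← funext hinv]
    exact hφ.memLq1
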